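/- Consider a server with $N$ files and $K$ users, where $K > N \ge 3$. For $F\in\mathbb{Z}^+$ write $[2^F]=\{1,\dots,2^F\}$; the files $W_1,\dots,W_N$ are independent and uniformly distributed on $[2^F]$, and $\mathbf W=(W_1,\dots,W_N)$. An $(M,R,F)$ code consists of $K$ caching functions $\phi_k:[2^F]^N\to[2^{\lfloor FM\rfloor}]$, a delivery encoding function $\psi:[2^F]^N\times[N]^K\to[2^{\lfloor FR\rfloor}]$ and $K$ decoding functions $\mu_k:[2^{\lfloor FM\rfloor}]\times[2^{\lfloor FR\rfloor}]\times[N]^K\to[2^F]$. Its error probability is $$P_e=\max_{\mathbf d\in[N]^K}\Pr\Big\{\exists k:\ \mu_k\big(\phi_k(\mathbf W),\psi(\mathbf W,\mathbf d),\mathbf d\big)\ne W_{d_k}\Big\}.$$ For $R, M \ge 0$ the pair $(R,M)$ is achievable if for every $\varepsilon>0$ there exist arbitrarily large $F$ and $(M,R,F)$ codes with $P_e<\varepsilon$. For $t\in[K]$ let $$\alpha_t=\frac{K(K-t)}{(t+1)(tN-1)}-\frac{N(K-1)}{tN-1},$$ and let $t^*\in[K]$ be any minimizer of $\alpha_t$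 over $t\in[K]$. Then for every real $M$ with $\frac1K\le M\le\frac{t^*N}{K}$ the pair $(R_c(M),M)$ is achievable, where $$R_c(M)=\begin{cases}-N\left(\frac12M-1+\frac1{2K}\right), & \frac1K\le M\le\frac{N-1}{K},\\[4pt] \frac{1}{(t^*-1)N+1}\left(\frac{K(K-t^*)}{t^*+1}-N\left(K-\frac N2\right)\right)\left(M-\frac{N-1}{K}\right)+N-\frac{N^2}{2K}, & \frac{N-1}{K}\le M\le\frac{t^*N}{K}.\end{cases}$$ -/

import Mathlib

open MeasureTheory ProbabilityTheory

namespace CodedCaching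

noncomputable section

/-- An `(M, R, F)` caching and delivery code for `N` files of `F` bits each and `K` users.
The set `{1, …, 2 ^ F}` is modelled by `Fin (2 ^ F)`, and similarly for the caches and the
message; a database is a function `Fin N → Fin (2 ^ F)`, a demand vector is a function
`Fin K → Fin N`. -/
structure Code (N K : ℕ) (M R : ℝ) (F : ℕ) where
  /-- the caching functions `φ_k` -/
  cache : Fin K → (Fin N → Fin (2 ^ F)) → Fin (2 ^ ⌊(F : ℝ) * M⌋₊)
  /-- the delivery encoding function `ψ` -/
  encode : (Fin N → Fin (2 ^ F)) → (Fin K → Fin N) → Fin (2 ^ ⌊(F : ℝ) * R⌋₊)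
  /-- the decoding functions `μ_k` -/
  decode : Fin K → Fin (2 ^ ⌊(F : ℝ) * M⌋₊) → Fin (2 ^ ⌊(F : ℝ) * R⌋₊) →
    (Fin K → Fin N) → Fin (2 ^ F)

/-- The law of the database: `N` independent files, each uniformly distributed. -/
def databaseLaw (N F : ℕ) : Measure (Fin N → Fin (2 ^ F)) :=
  Measure.pi fun _ => uniformOn (Set.univ : Set (Fin (2 ^ F)))

/-- The databases for which some user fails to recover the file that it requests. -/
def Code.errorEvent {N K : ℕ} {M R : ℝ} {F : ℕ} (c : Code N K M R F) (d : Fin K → Fin N) :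
    Set (Fin N → Fin (2 ^ F)) :=
  {W | ∃ k : Fin K, c.decode k (c.cache k W) (c.encode W d) d ≠ W (d k)}

/-- The probability of error, in the worst case over all demand vectors
(a maximum over a finite set). -/
def Code.errorProb {N K : ℕ} {M R : ℝ} {F : ℕ} (c : Code N K M R F) : ℝ :=
  ⨆ d : Fin K → Fin N, (databaseLaw N F).real (c.errorEvent d)

/-- The delivery rate-cache capacity pair `(R, M)` is achievable: for every `ε > 0` there are
`(M, R, F)` codes of error probability less than `ε`, with `F` as large as desired. -/
def Achievable (N K : ℕ) (R M : ℝ) : Prop :=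
  0 ≤ R ∧ 0 ≤ M ∧
    ∀ ε : ℝ, 0 < ε → ∀ F₀ : ℕ, ∃ F : ℕ, F₀ ≤ F ∧ 0 < F ∧
      ∃ c : Code N K M R F, c.errorProb < ε

/-- The slope `α_t` of the line through the points `(1 / K, N - N / K)` and
`(t N / K, (K - t) / (t + 1))` of the cache capacity-delivery rate plane. -/
def slope (N K t : ℕ) : ℝ :=
  (K * (K - t) : ℝ) / ((t + 1) * (t * N - 1)) - (N * (K - 1) : ℝ) / (t * N - 1)

/-- `t` is a minimizer of `α_t` over `t ∈ {1, …, K}`. -/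
def IsOptimalIndex (N K t : ℕ) : Prop :=
  t ∈ Finset.Icc 1 K ∧ ∀ s ∈ Finset.Icc 1 K, slope N K t ≤ slope N K s

/-- The piecewise linear trade-off `R_c`, with breakpoint `(N - 1) / K`, where both formulas
give `N - N ^ 2 / (2 K)`. -/
def tradeoff (N K t : ℕ) (M : ℝ) : ℝ :=
  if M ≤ ((N : ℝ) - 1) / K then
    -(N : ℝ) * (1 / 2 * M - 1 + 1 / (2 * K))
  else
    1 / (((t : ℝ) - 1) * N + 1) * ((K * (K - t) : ℝ) / (t + 1) - N * (K - (N : ℝ) / 2)) *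
      (M - ((N : ℝ) - 1) / K) + N - (N : ℝ) ^ 2 / (2 * K)

end

end CodedCaching

/-! The graph of `tradeoff` joins three points, and only linear zero-error codes are needed. The
left end is reached by `linearScheme_sum`, the right end by `linearScheme_subsets`. The corner at
`(N - 1) / K` lies on the line of slope `-N / 2` through the points of `linearScheme_sum` and
`linearScheme_pairs`.

Ordinary memory sharing mixes schemes with rational weights, whereas `Achievable` fixes `M` and `R`
with no slack, so a general point of a segment needs room for rounding. That room comes from
`linearScheme_sum_compl`, whose point is strictly below the line when `N ≥ 3`. The strict region is
open and convex, so a point in it joined to a point of its closure gives a segment inside it, except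
possibly for the latter end (`mem_strictRegion_of_segment`). This covers the open first segment,
hence the corner, hence the second segment up to its right end. The two outer ends are achieved
exactly by their own schemes. -/

namespace CodedCaching

/-! ### Binary linear schemes and the codes they give -/

/-- The caching maps `cache` admit a linear delivery of at most `r` bits for the demand `d`:
by linearity, decodability says that a database invisible to user `k` vanishes at file `d k`. -/
def Delivers {N K : ℕ} {P : Fin N → Type} {C : Fin K → Type}
    (cache : ∀ k, (∀ n, P n → ZMod 2) →+ (C k → ZMod 2)) (r : ℕ) (d : Fin K → Fin N) : Prop :=
  ∃ (T : Type) (_ : Fintype T), Fintype.card T ≤ r ∧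
    ∃ enc : (∀ n, P n → ZMod 2) →+ (T → ZMod 2),
      ∀ k W, cache k W = 0 → enc W = 0 → W (d k) = 0

/-- There is a binary linear zero-error scheme for `N` files of `p` bits and `K` users, with
caches of at most `m` bits and messages of at most `r` bits. -/
def LinearScheme (N K p m r : ℕ) : Prop :=
  ∃ (P : Fin N → Type) (_ : ∀ n, Fintype (P n)) (C : Fin K → Type) (_ : ∀ k, Fintype (C k)),
    (∀ n, Fintype.card (P n) = p) ∧ (∀ k, Fintype.card (C k) ≤ m) ∧
      ∃ cache : ∀ k, (∀ n, P n → ZMod 2) →+ (C k → ZMod 2), ∀ d, Delivers cache r d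

/-- If some file is not requested, then sending all requested files takes at most
`(N - 1) * p` bits. -/
theorem delivers_of_not_surjective {N K p r : ℕ} {P : Fin N → Type} [∀ n, Fintype (P n)]
    {C : Fin K → Type} (cache : ∀ k, (∀ n, P n → ZMod 2) →+ (C k → ZMod 2))
    (hP : ∀ n, Fintype.card (P n) = p) (hr : (N - 1) * p ≤ r) {d : Fin K → Fin N}
    (hd : ¬ Function.Surjective d) : Delivers cache r d := by
  classical
  obtain ⟨a, ha⟩ := not_forall.1 hd
  refine ⟨Σ n : {n : Fin N // n ≠ a}, P n, inferInstance, ?_,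
    AddMonoidHom.mk' (fun W x => W x.1 x.2) (fun _ _ => rfl), ?_⟩
  · simpa [Fintype.card_sigma, hP] using hr
  · intro k W _ hW
    funext x
    exact congrFun hW ⟨⟨d k, fun h => ha ⟨k, h⟩⟩, x⟩

theorem LinearScheme.zero (N K : ℕ) : LinearScheme N K 0 0 0 :=
  ⟨fun _ => Empty, inferInstance, fun _ => Empty, inferInstance, by simp, by simp, fun _ => 0,
    fun _ => ⟨Empty, inferInstance, by simp, 0, fun _ _ _ _ => Subsingleton.elim _ _⟩⟩

/-- Juxtaposition of two schemes, each applied to its own part of every file. -/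
theorem LinearScheme.add {N K p m r p' m' r' : ℕ} (h : LinearScheme N K p m r)
    (h' : LinearScheme N K p' m' r') : LinearScheme N K (p + p') (m + m') (r + r') := by
  obtain ⟨P, _, C, _, hP, hC, c, hc⟩ := h
  obtain ⟨P', _, C', _, hP', hC', c', hc'⟩ := h'
  let left : (∀ n, P n ⊕ P' n → ZMod 2) →+ (∀ n, P n → ZMod 2) :=
    AddMonoidHom.mk' (fun W n x => W n (.inl x)) (fun _ _ => rfl)
  let right : (∀ n, P n ⊕ P' n → ZMod 2) →+ (∀ n, P' n → ZMod 2) :=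
    AddMonoidHom.mk' (fun W n x => W n (.inr x)) (fun _ _ => rfl)
  let join : ∀ A A' : Type, (∀ f : (∀ n, P n → ZMod 2) →+ (A → ZMod 2),
      ∀ f' : (∀ n, P' n → ZMod 2) →+ (A' → ZMod 2),
      (∀ n, P n ⊕ P' n → ZMod 2) →+ (A ⊕ A' → ZMod 2)) := fun A A' f f' =>
    AddMonoidHom.mk' (fun W => Sum.elim (f (left W)) (f' (right W))) (by
      intro W W'
      funext x
      cases x <;> simp)
  have join_zero : ∀ {A A' : Type} {f : (∀ n, P n → ZMod 2) →+ (A → ZMod 2)}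
      {f' : (∀ n, P' n → ZMod 2) →+ (A' → ZMod 2)} {W}, join A A' f f' W = 0 →
      f (left W) = 0 ∧ f' (right W) = 0 := fun h =>
    ⟨funext fun x => congrFun h (.inl x), funext fun x => congrFun h (.inr x)⟩
  refine ⟨fun n => P n ⊕ P' n, inferInstance, fun k => C k ⊕ C' k, inferInstance, ?_, ?_,
    fun k => join _ _ (c k) (c' k), fun d => ?_⟩
  · simp [hP, hP']
  · intro k
    simpa using add_le_add (hC k) (hC' k)
  · obtain ⟨T, _, hT, e, he⟩ := hc d
    obtain ⟨T', _, hT', e', he'⟩ := hc' d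
    refine ⟨T ⊕ T', inferInstance, by simpa using add_le_add hT hT', join _ _ e e', ?_⟩
    intro k W h₁ h₂
    have hl := he k _ (join_zero h₁).1 (join_zero h₂).1
    have hr := he' k _ (join_zero h₁).2 (join_zero h₂).2
    funext x
    cases x with
    | inl x => exact congrFun hl x
    | inr x => exact congrFun hr x

theorem LinearScheme.mul {N K p m r : ℕ} (h : LinearScheme N K p m r) (b : ℕ) :
    LinearScheme N K (b * p) (b * m) (b * r) := by
  induction b with
  | zero => simpa using LinearScheme.zero N K
  | succ b ih => simpa [add_mul] using ih.add h

/-- A linear scheme gives a code without errors. -/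
theorem LinearScheme.exists_code {N K F m r : ℕ} (h : LinearScheme N K F m r) {M R : ℝ}
    (hm : (m : ℝ) ≤ F * M) (hr : (r : ℝ) ≤ F * R) :
    ∃ c : Code N K M R F, c.errorProb = 0 := by
  classical
  obtain ⟨P, _, C, _, hP, hC, cache, hc⟩ := h
  choose T hTf hT enc henc using hc
  have eP : ∀ n, Nonempty (Fin (2 ^ F) ≃ (P n → ZMod 2)) := fun n =>
    ⟨Fintype.equivOfCardEq (by simp [hP])⟩
  have eC : ∀ k, Nonempty ((C k → ZMod 2) ↪ Fin (2 ^ ⌊(F : ℝ) * M⌋₊)) := fun k =>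
    Function.Embedding.nonempty_of_card_le (by
      simpa using Nat.pow_le_pow_right two_pos ((hC k).trans (Nat.le_floor hm)))
  have eT : ∀ d, Nonempty ((T d → ZMod 2) ↪ Fin (2 ^ ⌊(F : ℝ) * R⌋₊)) := fun d =>
    Function.Embedding.nonempty_of_card_le (by
      simpa using Nat.pow_le_pow_right two_pos ((hT d).trans (Nat.le_floor hr)))
  replace eP := fun n => (eP n).some
  replace eC := fun k => (eC k).some
  replace eT := fun d => (eT d).some
  let bits : (Fin N → Fin (2 ^ F)) → ∀ n, P n → ZMod 2 := fun W n => eP n (W n)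
  let φ : Fin K → (Fin N → Fin (2 ^ F)) → Fin (2 ^ ⌊(F : ℝ) * M⌋₊) :=
    fun k W => eC k (cache k (bits W))
  let ψ : (Fin N → Fin (2 ^ F)) → (Fin K → Fin N) → Fin (2 ^ ⌊(F : ℝ) * R⌋₊) :=
    fun W d => eT d (enc d (bits W))
  have key : ∀ k d W W', φ k W = φ k W' → ψ W d = ψ W' d → W (d k) = W' (d k) := by
    intro k d W W' h₁ h₂
    have h₁ := (eC k).injective h₁
    have h₂ := (eT d).injective h₂
    have := henc d k (bits W - bits W') (by simp [h₁]) (by simp [h₂])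
    exact (eP _).injective (sub_eq_zero.1 this)
  -- The decoder takes any database consistent with cache and message; by `key` the choice does not
  -- matter. The default `0` is never used on actual inputs.
  let c : Code N K M R F := ⟨φ, ψ, fun k x y d =>
    if h : ∃ W, φ k W = x ∧ ψ W d = y then h.choose (d k) else ⟨0, by positivity⟩⟩
  have hc : ∀ d, c.errorEvent d = ∅ := by
    intro d
    refine Set.eq_empty_of_forall_notMem ?_
    rintro W ⟨k, hk⟩
    have h : ∃ W', φ k W' = φ k W ∧ ψ W' d = ψ W d := ⟨W, rfl, rfl⟩
    refine hk ?_
    change (if h : ∃ W', φ k W' = φ k W ∧ ψ W' d = ψ W d then h.choose (d k) else _) = _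
    rw [dif_pos h]
    exact key _ _ _ _ h.choose_spec.1 h.choose_spec.2
  exact ⟨c, by simp [Code.errorProb, hc]⟩

/-- A linear scheme achieves its rates exactly. -/
theorem LinearScheme.achievable {N K p m r : ℕ} (h : LinearScheme N K p m r) (hp : 0 < p)
    {M R : ℝ} (hm : (m : ℝ) ≤ p * M) (hr : (r : ℝ) ≤ p * R) : Achievable N K R M := by
  have hp' : (0 : ℝ) < p := by exact_mod_cast hp
  refine ⟨nonneg_of_mul_nonneg_right ((Nat.cast_nonneg r).trans hr) hp',
    nonneg_of_mul_nonneg_right ((Nat.cast_nonneg m).trans hm) hp', fun ε hε F₀ => ?_⟩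
  have hb : ∀ {x : ℕ} {y : ℝ}, (x : ℝ) ≤ p * y →
      (((F₀ + 1) * x : ℕ) : ℝ) ≤ ((F₀ + 1) * p : ℕ) * y := by
    intro x y hxy
    have : (0 : ℝ) ≤ (F₀ : ℝ) + 1 := by positivity
    push_cast
    rw [mul_assoc]
    exact mul_le_mul_of_nonneg_left hxy this
  obtain ⟨c, hc⟩ := (h.mul (F₀ + 1)).exists_code (hb hm) (hb hr)
  exact ⟨(F₀ + 1) * p, by nlinarith, by positivity, c, by rwa [hc]⟩

/-! ### The four schemes -/

/-- Coded placement: user `k` caches the sum over all files of their `k`-th parts. -/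
theorem linearScheme_sum {N K : ℕ} (hNK : N ≤ K) :
    LinearScheme N K K 1 (N * K - N) := by
  classical
  refine ⟨fun _ => Fin K, inferInstance, fun _ => Unit, inferInstance, by simp, by simp,
    fun k => AddMonoidHom.mk' (fun W _ => ∑ n, W n k)
      (fun W W' => by funext; simp [Finset.sum_add_distrib]), fun d => ?_⟩
  by_cases hd : Function.Surjective d
  swap
  · refine delivers_of_not_surjective (p := K) _ (by simp) ?_ hd
    rw [Nat.sub_mul, one_mul]
    omega
  choose u hu using hd
  -- The leader `u n` requests `n`. A leader's part of a file it does not request is sent plainly,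
  -- any other user's part as its difference from the part of the leader with the same demand. Each
  -- user's cached sum thus becomes its leader's, where only the requested file is unknown.
  refine ⟨{x : Fin N × Fin K // ¬ x.2 = u x.1}, inferInstance, ?_,
    AddMonoidHom.mk' (fun W x => W x.1.1 x.1.2 -
      if x.1.2 = u (d x.1.2) then 0 else W x.1.1 (u (d x.1.2))) ?_, ?_⟩
  · have h₁ : Fintype.card {x : Fin N × Fin K // x.2 = u x.1} = N := by
      conv_rhs => rw [← Fintype.card_fin N]
      exact Fintype.card_congr ⟨fun x => x.1.1, fun n => ⟨(n, u n), rfl⟩,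
        fun ⟨⟨n, k⟩, h⟩ => Subtype.ext (Prod.ext rfl (by simpa using h.symm)), fun _ => rfl⟩
    have := Fintype.card_subtype_compl (fun x : Fin N × Fin K => x.2 = u x.1)
    rw [this, h₁]
    simp
  · intro W W'
    funext x
    simp only [Pi.add_apply]
    split_ifs <;> ring
  · intro k W h₁ h₂
    have hz : ∀ n j, j ≠ u n →
        W n j - (if j = u (d j) then 0 else W n (u (d j))) = 0 :=
      fun n j h => congrFun h₂ ⟨(n, j), h⟩
    have hlead : ∀ n a, n ≠ a → W n (u a) = 0 := by
      intro n a hna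
      have := hz n (u a) (fun h => hna (by rw [← hu n, ← h, hu]))
      simpa [hu] using this
    have hclone : ∀ n j, W n j = W n (u (d j)) := by
      intro n j
      by_cases hj : j = u (d j)
      · rw [← hj]
      · by_cases hn : j = u n
        · exact absurd (by rw [hn, hu]) hj
        · have := hz n j hn
          rw [if_neg hj] at this
          exact sub_eq_zero.1 this
    have hsum : ∑ n, W n (u (d k)) = 0 := by
      have h : ∑ n, W n k = 0 := congrFun h₁ ()
      rw [← h]
      exact Finset.sum_congr rfl fun n _ => (hclone n k).symm
    rw [Finset.sum_eq_single_of_mem (d k) (Finset.mem_univ _)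
      (fun n _ hn => hlead n _ hn)] at hsum
    funext j
    rw [hclone]
    by_cases h : d k = d j
    · rw [← h]; exact hsum
    · exact hlead _ _ h

/-- Uncoded placement of the `k`-th part of every file at user `k`, with a delivery that skips
the pairs of users outside a set of `N` users requesting all requested files. -/
theorem linearScheme_pairs {N K : ℕ} (hNK : N ≤ K) :
    LinearScheme N K K N (K.choose 2 - (K - N).choose 2) := by
  classical
  refine ⟨fun _ => Fin K, inferInstance, fun _ => Fin N, inferInstance, by simp, by simp,
    fun k => AddMonoidHom.mk' (fun W n => W n k) (fun _ _ => rfl), fun d => ?_⟩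
  -- `L` is padded to exactly `N` users even if fewer files are requested, so that the message
  -- length does not depend on `d`.
  obtain ⟨L, hL, hLd⟩ : ∃ L : Finset (Fin K), L.card = N ∧ ∀ k, ∃ u ∈ L, d u = d k := by
    have h : ∀ n : Finset.univ.image d, ∃ k, d k = n := fun n => by
      simpa using (Finset.mem_image.1 n.2)
    choose u hu using h
    have hc : (Finset.univ.image u).card ≤ N :=
      Finset.card_image_le.trans (by simpa using Finset.card_le_univ (Finset.univ.image d))
    obtain ⟨L, hL₁, -, hL₂⟩ := Finset.exists_subsuperset_card_eq
      (Finset.subset_univ (Finset.univ.image u)) hc (by simpa using hNK)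
    exact ⟨L, hL₂, fun k => ⟨u ⟨d k, by simp⟩, hL₁ (by simp), hu _⟩⟩
  refine ⟨↥(Finset.powersetCard 2 (Finset.univ : Finset (Fin K)) \ Finset.powersetCard 2 Lᶜ),
    inferInstance, ?_, AddMonoidHom.mk'
      (fun W S => ∑ i ∈ S.1, ∑ j ∈ S.1.erase i, W (d i) j) ?_, ?_⟩
  · rw [Fintype.card_coe, Finset.card_sdiff_of_subset
      (Finset.powersetCard_mono (Finset.subset_univ _))]
    simp [Finset.card_compl, hL]
  · intro W W'
    funext S
    simp [Finset.sum_add_distrib]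
  · intro k W h₁ h₂
    have hk : ∀ n, W n k = 0 := fun n => congrFun h₁ n
    have two : ∀ x : ZMod 2, x + x = 0 := CharTwo.add_self_eq_zero
    have hY : ∀ u ∈ L, ∀ j, W (d u) j + W (d j) u = 0 := by
      intro u hu j
      by_cases huj : u = j
      · rw [huj]; exact two _
      · have := congrFun h₂ ⟨{u, j}, by
          simp [Finset.mem_powersetCard, Finset.card_pair huj, Finset.insert_subset_iff, hu]⟩
        have e₁ : ({u, j} : Finset (Fin K)).erase u = {j} := by grind
        have e₂ : ({u, j} : Finset (Fin K)).erase j = {u} := by grind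
        simpa [Finset.sum_pair huj, e₁, e₂] using this
    funext j
    -- The pair `{k, j}` may be unsent; leaders `a`, `b` with the same demands replace it by the
    -- sent pairs `{a, j}`, `{a, b}`, `{b, k}`, ending at the cached `W (d j) k`.
    obtain ⟨a, ha, hak⟩ := hLd k
    obtain ⟨b, hb, hbj⟩ := hLd j
    have h₁ := hY a ha j
    have h₂ := hY b hb k
    have h₃ := hY a ha b
    have h₄ := hk (d j)
    rw [hak, ← hbj] at h₁
    rw [hak] at h₃
    rw [← hbj] at h₄
    rw [h₄, zero_add] at h₂
    rw [h₂, zero_add] at h₃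
    rwa [h₃, add_zero] at h₁

/-- Uncoded placement along the `t`-subsets of users and delivery along the
`(t + 1)`-subsets. -/
theorem linearScheme_subsets (N K t : ℕ) :
    LinearScheme N K (K.choose t) (N * (K - 1).choose (t - 1)) (K.choose (t + 1)) := by
  classical
  refine ⟨fun _ => {A : Finset (Fin K) // A.card = t}, inferInstance,
    fun k => Fin N × {A : Finset (Fin K) // A.card = t ∧ k ∈ A}, inferInstance, by simp, ?_,
    fun k => AddMonoidHom.mk' (fun W x => W x.1 ⟨x.2.1, x.2.2.1⟩) (fun _ _ => rfl),
    fun d => ⟨{B : Finset (Fin K) // B.card = t + 1}, inferInstance, by simp,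
      AddMonoidHom.mk' (fun W B => ∑ i : {i // i ∈ B.1}, W (d i) ⟨B.1.erase i, by
        rw [Finset.card_erase_of_mem i.2, B.2, Nat.add_sub_cancel]⟩) ?_, ?_⟩⟩
  · intro k
    have e : {A : Finset (Fin K) // A.card = t ∧ k ∈ A} ↪
        ↥(Finset.powersetCard (t - 1) (Finset.univ.erase k)) :=
      ⟨fun A => ⟨A.1.erase k, by
        rw [Finset.mem_powersetCard, Finset.card_erase_of_mem A.2.2, A.2.1]
        exact ⟨Finset.erase_subset_erase _ (Finset.subset_univ _), rfl⟩⟩, by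
        intro A B h
        have := congrArg (insert k) (Subtype.ext_iff.1 h)
        simpa [Finset.insert_erase, A.2.2, B.2.2, Subtype.ext_iff] using this⟩
    have := Fintype.card_le_of_embedding e
    rw [Fintype.card_coe, Finset.card_powersetCard, Finset.card_erase_of_mem (Finset.mem_univ _),
      Finset.card_univ, Fintype.card_fin] at this
    rw [Fintype.card_prod, Fintype.card_fin]
    exact Nat.mul_le_mul_left _ this
  · intro W W'
    funext B
    simp [Finset.sum_add_distrib]
  · intro k W h₁ h₂
    funext A
    by_cases hkA : k ∈ A.1
    · exact congrFun h₁ (d k, ⟨A.1, A.2, hkA⟩)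
    -- In the sum sent for `insert k A`, every term other than the wanted one is indexed by a set
    -- containing `k`, hence cached.
    · have h := congrFun h₂ ⟨insert k A.1, by rw [Finset.card_insert_of_notMem hkA, A.2]⟩
      have hk : k ∈ insert k A.1 := Finset.mem_insert_self _ _
      simp only [AddMonoidHom.mk'_apply, Pi.zero_apply] at h
      rw [Finset.sum_eq_single_of_mem ⟨k, hk⟩ (Finset.mem_univ _)] at h
      · rw [Pi.zero_apply, ← h]
        congr 1
        exact Subtype.ext (Finset.erase_insert hkA).symm
      · intro i _ hi
        exact congrFun h₁ (d i, ⟨_, by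
          rw [Finset.card_erase_of_mem i.2, Finset.card_insert_of_notMem hkA, A.2,
            Nat.add_sub_cancel], Finset.mem_erase.2 ⟨fun h => hi (Subtype.ext h.symm), hk⟩⟩)

/-- Coded placement of sums over `N - 1` files. The part of file `n` with index `(j, m)`, where
`m ≠ n`, is cached by user `j` only in its sum over all files but `m`. -/
theorem linearScheme_sum_compl {N K : ℕ} (hN : 2 ≤ N) (hNK : N < K) :
    LinearScheme N K (K * (N - 1)) N (N * (K * (N - 1)) - N * N + 1) := by
  classical
  have : Nontrivial (Fin N) := Fin.nontrivial_iff_two_le.2 hN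
  let P : Fin N → Type := fun n => Fin K × {m : Fin N // m ≠ n}
  have hP : ∀ n, Fintype.card (P n) = K * (N - 1) := fun n => by
    simp [P]
  -- the parts of the files, extended by zero
  let X : Fin N → Fin K → Fin N → (∀ n, P n → ZMod 2) →+ ZMod 2 := fun n j m =>
    AddMonoidHom.mk' (fun W => if h : m ≠ n then W n (j, ⟨m, h⟩) else 0) (by
      intro W W'
      split_ifs <;> simp)
  have X_of_ne : ∀ {n m} (h : m ≠ n) j W, X n j m W = W n (j, ⟨m, h⟩) :=
    fun h j W => dif_pos h
  have X_self : ∀ n j W, X n j n W = 0 := fun n j W => dif_neg (not_not.2 rfl)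
  refine ⟨P, inferInstance, fun _ => Fin N, inferInstance, hP, by simp,
    fun k => AddMonoidHom.mk' (fun W m => ∑ n, X n k m W)
      (fun W W' => by funext; simp [Finset.sum_add_distrib]), fun d => ?_⟩
  by_cases hd : Function.Surjective d
  swap
  · refine delivers_of_not_surjective _ hP ?_ hd
    -- The bound amounts to `N + 1 ≤ K`.
    obtain ⟨n, rfl⟩ := Nat.exists_eq_add_of_le' (show 1 ≤ N by omega)
    obtain ⟨l, rfl⟩ := Nat.exists_eq_add_of_le hNK
    have : (n + 1) * (n + 1) ≤ (n + 1) * ((n + 1 + 1 + l) * n) :=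
      Nat.mul_le_mul_left _ (by nlinarith)
    simp only [Nat.add_sub_cancel]
    zify [this]
    nlinarith [Int.natCast_nonneg n, Int.natCast_nonneg l,
      mul_nonneg (Int.natCast_nonneg n) (Int.natCast_nonneg l)]
  choose u hu using hd
  have hui : Function.Injective u := Function.LeftInverse.injective hu
  choose f hf using fun n : Fin N => exists_ne n
  -- For each file `n`, the `N - 1` parts at its own leader and one reference part at `(u (f n), f
  -- n)` are omitted: `N * N` in all. The sum of the reference parts is the one extra bit.
  let omitted : (Σ n : Fin N, Option {m : Fin N // m ≠ n}) → Σ n, P n := fun x =>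
    ⟨x.1, x.2.elim (u (f x.1), ⟨f x.1, hf x.1⟩) (fun m => (u x.1, m))⟩
  have omitted_inj : Function.Injective omitted := by
    rintro ⟨n, x⟩ ⟨n', x'⟩ h
    obtain rfl : n = n' := congrArg Sigma.fst h
    have h := eq_of_heq (Sigma.mk.inj h).2
    have hne : u (f n) ≠ u n := fun h => hf n (hui h)
    rcases x with _ | x <;> rcases x' with _ | x'
    · rfl
    · exact absurd (congrArg Prod.fst h) hne
    · exact absurd (congrArg Prod.fst h).symm hne
    · rw [show x = x' from congrArg Prod.snd h]
  -- Non-leaders are compared with their leader; the parts `(u m, m)` of file `n` are compared with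
  -- its reference part; the rest is sent plainly.
  let term : (Σ n, P n) → (∀ n, P n → ZMod 2) →+ ZMod 2 := fun x =>
    X x.1 x.2.1 x.2.2 - if x.2.1 ≠ u (d x.2.1) then X x.1 (u (d x.2.1)) x.2.2
      else if x.2.1 = u x.2.2 then X x.1 (u (f x.1)) (f x.1) else 0
  refine ⟨Option {x : Σ n, P n // ¬ x ∈ Set.range omitted}, inferInstance, ?_,
    AddMonoidHom.mk' (fun W x => x.elim (∑ n, X n (u (f n)) (f n) W) fun x => term x.1 W) ?_, ?_⟩
  · have h₁ : Fintype.card {x : Σ n, P n // x ∈ Set.range omitted} = N * N := by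
      rw [← Fintype.card_congr (Equiv.ofInjective omitted omitted_inj)]
      simp [Fintype.card_sigma, Nat.sub_add_cancel (show 1 ≤ N by omega)]
    rw [Fintype.card_option, Fintype.card_subtype_compl, h₁]
    simp [Fintype.card_sigma, hP]
  · intro W W'
    funext x
    cases x <;> simp [Finset.sum_add_distrib]
  · intro k W h₁ h₂
    have hZ : ∀ m, ∑ n, X n k m W = 0 := fun m => congrFun h₁ m
    have hE : ∑ n, X n (u (f n)) (f n) W = 0 := congrFun h₂ none
    have hT : ∀ n j m (h : m ≠ n), (∀ y, omitted y ≠ ⟨n, j, m, h⟩) →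
        term ⟨n, j, m, h⟩ W = 0 := fun n j m h hy =>
      congrFun h₂ (some ⟨⟨n, j, m, h⟩, fun ⟨y, hy'⟩ => hy y hy'⟩)
    have hT' : ∀ n j m (h : m ≠ n), j ≠ u n → ¬ (j = u m ∧ m = f n) →
        term ⟨n, j, m, h⟩ W = 0 := by
      intro n j m h hj hjm
      refine hT n j m h ?_
      rintro ⟨n', y⟩ hy
      obtain rfl : n' = n := congrArg Sigma.fst hy
      have hy := eq_of_heq (Sigma.mk.inj hy).2
      rcases y with _ | y
      · have h₁ : f n' = m := congrArg (fun z : P n' => z.2.1) hy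
        have h₂ : u (f n') = j := congrArg Prod.fst hy
        exact hjm ⟨by rw [← h₂, h₁], h₁.symm⟩
      · exact hj (congrArg Prod.fst hy).symm
    -- every user sees what the leader with the same demand sees
    have hclone : ∀ n j m, X n j m W = X n (u (d j)) m W := by
      intro n j m
      by_cases hj : j = u (d j)
      · rw [← hj]
      rcases eq_or_ne m n with rfl | hmn
      · rw [X_self, X_self]
      have hju : ∀ a, j ≠ u a := fun a h => hj (by rw [h, hu])
      have := hT' n j m hmn (hju n) (fun h => hju m h.1)
      simpa [term, hj, sub_eq_zero] using this
    have hlead : ∀ n a m, a ≠ n → a ≠ m → X n (u a) m W = 0 := by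
      intro n a m han ham
      rcases eq_or_ne m n with rfl | hmn
      · rw [X_self]
      have := hT' n (u a) m hmn (fun h => han (hui h)) (fun h => ham (hui h.1))
      simpa [term, hu, hui.eq_iff, ham] using this
    have hrow : ∀ n a, a ≠ n → X n (u a) a W = X n (u (f n)) (f n) W := by
      intro n a han
      rcases eq_or_ne a (f n) with rfl | haf
      · rfl
      have := hT' n (u a) a han (fun h => han (hui h)) (fun h => haf h.2)
      simpa [term, hu, sub_eq_zero] using this
    set a := d k with ha
    have hZ' : ∀ m, ∑ n, X n (u a) m W = 0 := fun m => by
      rw [← hZ m]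
      exact Finset.sum_congr rfl fun n _ => (hclone n k m).symm
    have hself : ∀ m, m ≠ a → X a (u a) m W = 0 := by
      intro m hm
      have := hZ' m
      rwa [Finset.sum_eq_single_of_mem a (Finset.mem_univ _)
        (fun n _ hn => hlead n a m hn.symm hm.symm)] at this
    -- By `hrow`, the cached sum with index `a` is the sum of the reference parts of all files but
    -- `a`; the extra bit then isolates that of `a`.
    have hfa : X a (u (f a)) (f a) W = 0 := by
      have h := hZ' a
      rw [← Finset.add_sum_erase _ _ (Finset.mem_univ a)] at h hE
      rw [X_self, zero_add] at h
      rw [Finset.sum_congr rfl fun n hn => (hrow n a (Finset.ne_of_mem_erase hn).symm).symm,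
        h, add_zero] at hE
      exact hE
    funext ⟨j, m, hm⟩
    rw [← X_of_ne hm j W, hclone]
    rcases eq_or_ne (d j) a with h | h
    · rw [h]
      exact hself m hm
    · rcases eq_or_ne (d j) m with h' | h'
      · subst h'
        rw [hrow _ _ h]
        exact hfa
      · exact hlead _ _ _ h h'

/-! ### Memory sharing with slack -/

/-- The pairs `(M, R)` that exceed the cache capacity and the delivery rate of some linear
scheme strictly. -/
def strictRegion (N K : ℕ) : Set (ℝ × ℝ) :=
  {x | ∃ p m r, LinearScheme N K p m r ∧ 0 < p ∧ (m : ℝ) < p * x.1 ∧ (r : ℝ) < p * x.2}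

theorem achievable_of_mem_strictRegion {N K : ℕ} {M R : ℝ} (h : (M, R) ∈ strictRegion N K) :
    Achievable N K R M := by
  obtain ⟨p, m, r, h, hp, hm, hr⟩ := h
  exact h.achievable hp hm.le hr.le

theorem isOpen_strictRegion (N K : ℕ) : IsOpen (strictRegion N K) := by
  simp only [strictRegion, Set.ofPred_exists, Set.ofPred_and]
  refine isOpen_iUnion fun p => isOpen_iUnion fun m => isOpen_iUnion fun r => ?_
  exact isOpen_const.inter (isOpen_const.inter
    ((isOpen_lt (by fun_prop) (by fun_prop)).inter (isOpen_lt (by fun_prop) (by fun_prop))))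

theorem LinearScheme.mem_closure {N K p m r : ℕ} (h : LinearScheme N K p m r) (hp : 0 < p)
    {M R : ℝ} (hm : (m : ℝ) ≤ p * M) (hr : (r : ℝ) ≤ p * R) :
    (M, R) ∈ closure (strictRegion N K) := by
  have hp' : (0 : ℝ) < p := by exact_mod_cast hp
  refine Metric.mem_closure_iff.2 fun ε hε =>
    ⟨(M + ε / 2, R + ε / 2), ⟨p, m, r, h, hp, ?_, ?_⟩, ?_⟩
  · nlinarith [mul_pos hp' hε]
  · nlinarith [mul_pos hp' hε]
  · simp [Prod.dist_eq, abs_of_pos hε]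
    linarith

/-- Rounding the numbers of copies of two schemes in a mixture of total size `L` is harmless
for large `L`. -/
theorem combination_lt {p₁ p₂ m₁ m₂ a b s₁ s₂ L x y : ℝ} (hp₁ : 0 < p₁) (hp₂ : 0 < p₂)
    (hm₁ : 0 ≤ m₁) (hm₂ : 0 ≤ m₂) (hx : 0 < x) (hy : 0 < y) (ha : 0 ≤ a) (hb : 0 ≤ b)
    (hab : a + b = 1)
    (h₁ : s₁ ≤ L * a / p₁) (h₁' : L * a / p₁ < s₁ + 1)
    (h₂ : s₂ ≤ L * b / p₂) (h₂' : L * b / p₂ < s₂ + 1)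
    (hL : (p₁ + p₂) * (a * x + b * y) < L * (a * (x - m₁ / p₁) + b * (y - m₂ / p₂))) :
    s₁ * m₁ + s₂ * m₂ < (s₁ * p₁ + s₂ * p₂) * (a * x + b * y) := by
  rw [div_lt_iff₀ hp₁] at h₁'
  rw [div_lt_iff₀ hp₂] at h₂'
  have e₁ : s₁ * m₁ ≤ L * (a * (m₁ / p₁)) := by
    calc s₁ * m₁ ≤ L * a / p₁ * m₁ := mul_le_mul_of_nonneg_right h₁ hm₁
      _ = _ := by ring
  have e₂ : s₂ * m₂ ≤ L * (b * (m₂ / p₂)) := by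
    calc s₂ * m₂ ≤ L * b / p₂ * m₂ := mul_le_mul_of_nonneg_right h₂ hm₂
      _ = _ := by ring
  have hz : 0 ≤ a * x + b * y := by positivity
  have e₃ : L - (p₁ + p₂) ≤ s₁ * p₁ + s₂ * p₂ := by
    have : L = L * a + L * b := by rw [← mul_add, hab, mul_one]
    linarith
  have e₄ := mul_le_mul_of_nonneg_right e₃ hz
  nlinarith

/-- Mixing about `L * a / p₁` and `L * b / p₂` copies gives slack growing linearly in `L`, against a
bounded rounding loss. -/
theorem convex_strictRegion (N K : ℕ) : Convex ℝ (strictRegion N K) := by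
  rintro ⟨x₁, x₂⟩ ⟨p₁, m₁, r₁, h₁, hp₁, hm₁, hr₁⟩ ⟨y₁, y₂⟩ ⟨p₂, m₂, r₂, h₂, hp₂, hm₂, hr₂⟩
    a b ha hb hab
  have hp₁' : (0 : ℝ) < p₁ := by exact_mod_cast hp₁
  have hp₂' : (0 : ℝ) < p₂ := by exact_mod_cast hp₂
  simp only at hm₁ hr₁ hm₂ hr₂
  have pos : ∀ {p m : ℕ} {x : ℝ}, (m : ℝ) < p * x → 0 < x := fun {p m x} h =>
    pos_of_mul_pos_right ((Nat.cast_nonneg m).trans_lt h) (Nat.cast_nonneg p)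
  have slack : ∀ {u v : ℝ}, 0 < u → 0 < v → 0 < a * u + b * v := by
    intro u v hu hv
    rcases ha.eq_or_lt with rfl | ha
    · obtain rfl : b = 1 := by linarith
      simpa using hv
    · exact add_pos_of_pos_of_nonneg (mul_pos ha hu) (mul_nonneg hb hv.le)
  have gap : ∀ {p m x : ℝ}, 0 < p → m < p * x → 0 < x - m / p := fun hp h =>
    sub_pos.2 ((div_lt_iff₀' hp).2 h)
  have hs := slack (gap hp₁' hm₁) (gap hp₂' hm₂)
  have hs' := slack (gap hp₁' hr₁) (gap hp₂' hr₂)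
  obtain ⟨L, hL⟩ := exists_nat_gt (max
    ((p₁ + p₂) * (a * x₁ + b * y₁) / (a * (x₁ - m₁ / p₁) + b * (y₁ - m₂ / p₂)))
    ((p₁ + p₂) * (a * x₂ + b * y₂) / (a * (x₂ - r₁ / p₁) + b * (y₂ - r₂ / p₂))))
  obtain ⟨hL₁, hL₂⟩ := max_lt_iff.1 hL
  rw [div_lt_iff₀ hs] at hL₁
  rw [div_lt_iff₀ hs'] at hL₂
  have hf₁ := Nat.floor_le (show 0 ≤ L * a / p₁ by positivity)
  have hf₁' := Nat.lt_floor_add_one (L * a / p₁)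
  have hf₂ := Nat.floor_le (show 0 ≤ L * b / p₂ by positivity)
  have hf₂' := Nat.lt_floor_add_one (L * b / p₂)
  have hm := combination_lt hp₁' hp₂' m₁.cast_nonneg m₂.cast_nonneg (pos hm₁) (pos hm₂) ha hb
    hab hf₁ hf₁' hf₂ hf₂' hL₁
  have hr := combination_lt hp₁' hp₂' r₁.cast_nonneg r₂.cast_nonneg (pos hr₁) (pos hr₂) ha hb
    hab hf₁ hf₁' hf₂ hf₂' hL₂
  refine ⟨_, _, _, (h₁.mul ⌊L * a / p₁⌋₊).add (h₂.mul ⌊L * b / p₂⌋₊), ?_, ?_, ?_⟩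
  -- With file size zero, `hm` would bound a nonnegative cache size strictly by zero.
  · refine Nat.pos_of_ne_zero fun h => ?_
    have h : (⌊L * a / p₁⌋₊ * p₁ + ⌊L * b / p₂⌋₊ * p₂ : ℝ) = 0 := by exact_mod_cast h
    rw [h, zero_mul] at hm
    exact hm.not_ge (by positivity)
  · simpa using hm
  · simpa using hr

/-- On a line through a point of the strict region, with abscissa `z₁`, and a point of its
closure, with abscissa `z₂`, all points from the first up to, but excluding, the second are in
the strict region. -/
theorem mem_strictRegion_of_segment {N K : ℕ} {c s z₁ z₂ z : ℝ}
    (h₁ : (z₁, c + s * z₁) ∈ strictRegion N K)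
    (h₂ : (z₂, c + s * z₂) ∈ closure (strictRegion N K))
    (hz : z ∈ Set.Ico z₁ z₂ ∨ z ∈ Set.Ioc z₂ z₁) :
    (z, c + s * z) ∈ strictRegion N K := by
  obtain ⟨a, ha, ha', rfl⟩ : ∃ a : ℝ, 0 < a ∧ a ≤ 1 ∧ a * z₁ + (1 - a) * z₂ = z := by
    have key : z₁ ≠ z₂ → (z - z₂) / (z₁ - z₂) * z₁ + (1 - (z - z₂) / (z₁ - z₂)) * z₂ = z := by
      intro h
      have := sub_ne_zero.2 h
      field_simp
      ring
    rcases hz with ⟨h, h'⟩ | ⟨h, h'⟩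
    · exact ⟨_, div_pos_of_neg_of_neg (by linarith) (by linarith),
        (div_le_one_of_neg (by linarith)).2 (by linarith), key (by rintro rfl; linarith)⟩
    · exact ⟨_, div_pos (by linarith) (by linarith),
        (div_le_one (by linarith)).2 (by linarith), key (by rintro rfl; linarith)⟩
  have := (convex_strictRegion N K).combo_interior_closure_mem_interior
    (by rwa [(isOpen_strictRegion N K).interior_eq]) h₂ ha (sub_nonneg.2 ha') (by ring)
  rw [(isOpen_strictRegion N K).interior_eq] at this
  convert this using 1
  ext
  · simp
  · simp; ring

/-! ### The trade-off curve -/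

/-- The open segment between the points `(1 / K, N - N / K)` of `linearScheme_sum` and
`(N / K, N - N * (N + 1) / (2 * K))` of `linearScheme_pairs` lies in the strict region, because
the point of `linearScheme_sum_compl` is strictly below it. -/
theorem mem_strictRegion_of_lt_of_lt {N K : ℕ} (hN : 3 ≤ N) (hNK : N < K) {z : ℝ}
    (hz₁ : 1 / (K : ℝ) < z) (hz₂ : z < (N : ℝ) / K) :
    (z, (N - N / (2 * K) : ℝ) + (-N / 2) * z) ∈ strictRegion N K := by
  have hN' : (3 : ℝ) ≤ N := by exact_mod_cast hN
  have hNK' : (N : ℝ) < K := by exact_mod_cast hNK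
  have hK : (0 : ℝ) < K := by linarith
  have hN₁ : (0 : ℝ) < (N : ℝ) - 1 := by linarith
  have h₁ : (1 / (K : ℝ), (N - N / (2 * K) : ℝ) + (-N / 2) * (1 / K)) ∈
      closure (strictRegion N K) := by
    refine (linearScheme_sum hNK.le).mem_closure (by omega) ?_ ?_
    · rw [mul_one_div_cancel hK.ne', Nat.cast_one]
    · rw [Nat.cast_sub (Nat.le_mul_of_pos_right _ (by omega))]
      push_cast
      apply le_of_eq
      field_simp
      ring
  have h₂ : ((N : ℝ) / K, (N - N / (2 * K) : ℝ) + (-N / 2) * (N / K)) ∈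
      closure (strictRegion N K) := by
    refine (linearScheme_pairs hNK.le).mem_closure (by omega) ?_ ?_
    · rw [mul_div_cancel₀ _ hK.ne']
    · rw [Nat.cast_sub (Nat.choose_le_choose _ (Nat.sub_le _ _)), Nat.cast_choose_two,
        Nat.cast_choose_two, Nat.cast_sub hNK.le]
      apply le_of_eq
      field_simp
      ring
  have hx : (K : ℝ) * (N - 1) * (N / (K * (N - 1)) + (N - 2) / (2 * K * N * (N - 1))) =
      N + (N - 2) / (2 * N) := by
    field_simp
  -- The first summand is the cache size of `linearScheme_sum_compl`. The second lowers the line by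
  -- half of the vertical gap above that scheme's point, leaving strict slack in both coordinates.
  set x : ℝ := N / (K * (N - 1)) + (N - 2) / (2 * K * N * (N - 1)) with hxdef
  have h₃ : (x, (N - N / (2 * K) : ℝ) + (-N / 2) * x) ∈ strictRegion N K := by
    refine ⟨_, _, _, linearScheme_sum_compl (by omega) hNK,
      Nat.mul_pos (by omega) (by omega), ?_, ?_⟩
    · rw [Nat.cast_mul, Nat.cast_sub (by omega), Nat.cast_one, hx]
      have : 0 < ((N : ℝ) - 2) / (2 * N) := div_pos (by linarith) (by linarith)
      linarith
    · have hle : N * N ≤ N * (K * (N - 1)) :=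
        Nat.mul_le_mul_left _ (hNK.le.trans (Nat.le_mul_of_pos_right _ (by omega)))
      rw [Nat.cast_add, Nat.cast_sub hle]
      push_cast [Nat.cast_sub (show 1 ≤ N by omega)]
      have e : (K : ℝ) * (N - 1) * (N - N / (2 * K) + -N / 2 * x) =
          N * (K * (N - 1)) - N * (N - 1) / 2 - N / 2 * (N + (N - 2) / (2 * N)) := by
        rw [← hx]
        field_simp
        ring
      have e' : (N : ℝ) / 2 * (N + (N - 2) / (2 * N)) = N * N / 2 + (N - 2) / 4 := by
        field_simp
        ring
      rw [e, e']
      linarith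
  rcases le_total x z with h | h
  · exact mem_strictRegion_of_segment h₃ h₂ (.inl ⟨h, hz₂⟩)
  · exact mem_strictRegion_of_segment h₃ h₁ (.inr ⟨hz₁, h⟩)

/-- The size of a cache of `linearScheme_subsets`, relative to the file size. -/
theorem cast_mul_choose_pred (N : ℕ) {K t : ℕ} (ht : 1 ≤ t) (hK : 1 ≤ K) :
    ((N * (K - 1).choose (t - 1) : ℕ) : ℝ) = K.choose t * (t * N / K) := by
  obtain ⟨t, rfl⟩ := Nat.exists_eq_add_of_le' ht
  obtain ⟨K, rfl⟩ := Nat.exists_eq_add_of_le' hK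
  have h : ((K + 1 : ℕ) : ℝ) * K.choose t = (K + 1).choose (t + 1) * (t + 1 : ℕ) := by
    exact_mod_cast Nat.add_one_mul_choose_eq K t
  have hK : ((K + 1 : ℕ) : ℝ) ≠ 0 := by positivity
  simp only [Nat.add_sub_cancel]
  rw [Nat.cast_mul, mul_div_assoc', eq_div_iff hK]
  linear_combination (N : ℝ) * h

/-- The message length of `linearScheme_subsets`, relative to the file size. -/
theorem cast_choose_add_one {K t : ℕ} (ht : t ≤ K) :
    (K.choose (t + 1) : ℝ) = K.choose t * ((K - t) / (t + 1)) := by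
  have h : (K.choose (t + 1) : ℝ) * (t + 1 : ℕ) = K.choose t * (K - t : ℕ) := by
    exact_mod_cast Nat.choose_succ_right_eq K t
  rw [Nat.cast_sub ht, Nat.cast_add_one] at h
  rw [mul_div_assoc', eq_div_iff (by positivity), h]

end CodedCaching

open CodedCaching in
theorem corollary1 (N K : ℕ) (hN : 3 ≤ N) (hNK : N < K)
    (t : ℕ) (ht : CodedCaching.IsOptimalIndex N K t)
    (M : ℝ) (hM₁ : 1 / (K : ℝ) ≤ M) (hM₂ : M ≤ (t : ℝ) * N / K) :
    CodedCaching.Achievable N K (CodedCaching.tradeoff N K t M) M := by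
  obtain ⟨ht₁, htK⟩ := Finset.mem_Icc.1 ht.1
  have hN' : (3 : ℝ) ≤ N := by exact_mod_cast hN
  have hNK' : (N : ℝ) < K := by exact_mod_cast hNK
  have ht' : (1 : ℝ) ≤ t := by exact_mod_cast ht₁
  have hK : (0 : ℝ) < K := by linarith
  have hlt : ((N : ℝ) - 1) / K < N / K := by gcongr; linarith
  have hline : ∀ z : ℝ, -(N : ℝ) * (1 / 2 * z - 1 + 1 / (2 * K)) =
      (N - N / (2 * K) : ℝ) + (-N / 2) * z := fun z => by ring
  rcases le_or_gt M (((N : ℝ) - 1) / K) with hM | hM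
  · rw [tradeoff, if_pos hM, hline]
    rcases hM₁.eq_or_lt with rfl | hM₁
    · refine (linearScheme_sum hNK.le).achievable (by omega) ?_ ?_
      · rw [mul_one_div_cancel hK.ne', Nat.cast_one]
      · rw [Nat.cast_sub (Nat.le_mul_of_pos_right _ (by omega))]
        push_cast
        apply le_of_eq
        field_simp
        ring
    · exact achievable_of_mem_strictRegion
        (mem_strictRegion_of_lt_of_lt hN hNK hM₁ (hM.trans_lt hlt))
  · rw [tradeoff, if_neg hM.not_ge]
    have hD : (0 : ℝ) < ((t : ℝ) - 1) * N + 1 := by nlinarith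
    set s : ℝ := 1 / (((t : ℝ) - 1) * N + 1) *
      ((K * (K - t) : ℝ) / (t + 1) - N * (K - (N : ℝ) / 2)) with hs
    have hend : s * ((t : ℝ) * N / K - ((N : ℝ) - 1) / K) + N - (N : ℝ) ^ 2 / (2 * K) =
        (K - t) / (t + 1) := by
      have e : (t : ℝ) * N / K - ((N : ℝ) - 1) / K = (((t : ℝ) - 1) * N + 1) / K := by ring
      rw [e, hs]
      field_simp
      ring
    have hpos : 0 < K.choose t := Nat.choose_pos htK
    have hscheme := linearScheme_subsets N K t
    have hm := (cast_mul_choose_pred N ht₁ (ht₁.trans htK)).le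
    have hr := (cast_choose_add_one htK).le
    rw [← hend] at hr
    rcases hM₂.eq_or_lt with rfl | hM₂
    · exact hscheme.achievable hpos hm hr
    · have hlin : ∀ z : ℝ, s * (z - ((N : ℝ) - 1) / K) + N - (N : ℝ) ^ 2 / (2 * K) =
          (N - (N : ℝ) ^ 2 / (2 * K) - s * (((N : ℝ) - 1) / K)) + s * z := fun z => by ring
      have hcorner := mem_strictRegion_of_lt_of_lt hN hNK
        (z := ((N : ℝ) - 1) / K) (by gcongr; linarith) hlt
      -- The two linear formulas agree at the corner, so the corner also starts the line of slope
      -- `s`.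
      have hc : (N - N / (2 * K) : ℝ) + (-N / 2) * (((N : ℝ) - 1) / K) =
          s * (((N : ℝ) - 1) / K - ((N : ℝ) - 1) / K) + N - (N : ℝ) ^ 2 / (2 * K) := by
        field_simp
        ring
      have hclosure := hscheme.mem_closure hpos hm hr
      rw [hc, hlin] at hcorner
      rw [hlin] at hclosure ⊢
      exact achievable_of_mem_strictRegion
        (mem_strictRegion_of_segment hcorner hclosure (.inl ⟨hM.le, hM₂⟩))
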